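/- Let $k$ be a field, $L$ a finite lattice, and $\mathcal{A}$ the incidence algebra of $L$ over $k$: it has basis the pairs $(x,y)$ with $x\le y$ in $L$, and multiplication $(x,y)(z,t)=(x,t)$ if $y=z$ and $0$ otherwise. Let $D^b$ be the bounded derived category of finite dimensional left $\mathcal{A}$-modules. For $\alpha\in L$ put $P_\alpha=\mathcal{A}\cdot(\alpha,\alpha)$. For an antichain $C\subseteq L$ all of whose elements are $\le\alpha$, put $$M_C^{\alpha}=P_\alpha\Big/\sum_{c\in C}\mathcal{A}\cdot(c,\alpha).$$ For $S\subseteq C$ let $\bigwedge S$ denote the meet of $S$ in the lattice $[\hat 0,\alpha]$, so that $\bigwedge\emptyset=\alpha$. The antichain $C$ is called boolean below $\alpha$ if for all subsets $S,S'\subseteq C$: (inclusive) $\bigwedge S\le\bigwedge S'$ implies $S'\subseteq S$; and (intersective) $(\bigwedge S)\vee(\bigwedge S')=\bigwedge(S\cap S')$. For $a\le b$ in $L$, the interval module of $I=[a,b]$, again written $I$, is $M_{C'}^{\,b}$, where $C'$ is the antichain of maximal elements of $\{x\in L : x<b,\ a\not\le x\}$. **Theorem.** Let $C$ be a boolean antichain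 below an element $\alpha\in L$, and let $I=[a,b]$ with $a\le b$ be an interval of $L$. Then there is at most one integer $p$ such that $\operatorname{Hom}_{D^b}(M_C^{\alpha},I[p])\neq 0$, and if such a $p$ exists, then this space is one-dimensional over $k$. -/

import Mathlib

open CategoryTheory

universe w u v

namespace LatticeIncidence

/-! ### The incidence algebra of a finite lattice -/

section Algebra

variable (k : Type u) [Field k] {L : Type v} [Lattice L] [Finite L] [DecidableEq L]
  [LocallyFiniteOrder L]

/-- The basis element `(x, y)` of the incidence algebra, for `x ≤ y`. The product of
`IncidenceAlgebra` is the one of the basis pairs: `(x, y)(y, t) = (x, t)`, and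
`(x, y)(z, t) = 0` for `y ≠ z`. -/
def basisElt (x y : L) (h : x ≤ y) : IncidenceAlgebra k L where
  toFun a b := if a = x ∧ b = y then 1 else 0
  eq_zero_of_not_le' := by
    rintro a b hab
    refine if_neg ?_
    rintro ⟨rfl, rfl⟩
    exact hab h

/-- The incidence algebra over a field of a finite lattice is finite dimensional. -/
instance finite_incidenceAlgebra : Module.Finite k (IncidenceAlgebra k L) :=
  let f : IncidenceAlgebra k L →ₗ[k] (L → L → k) :=
    { toFun := fun g => g
      map_add' := fun _ _ => rfl
      map_smul' := fun _ _ => rfl }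
  Module.Finite.of_injective f DFunLike.coe_injective

instance isNoetherianRing_incidenceAlgebra : IsNoetherianRing (IncidenceAlgebra k L) :=
  isNoetherian_of_tower k inferInstance

/-! ### Antichain modules and interval modules -/

/-- The left ideal `P_α = A e_α`, where `A` is the incidence algebra and `e_α = (α, α)`. -/
def projIdeal (α : L) : Ideal (IncidenceAlgebra k L) :=
  Ideal.span {basisElt k α α le_rfl}

/-- The left ideal `N_C^α = ∑_{c ∈ C} A (c, α)`. It is contained in `P_α`, since
`(c, α) = (c, α) e_α`. -/
def antichainIdeal (α : L) (C : Set L) : Ideal (IncidenceAlgebra k L) :=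
  Ideal.span {f | ∃ c ∈ C, ∃ h : c ≤ α, f = basisElt k c α h}

/-- The left module `M_C^α = P_α / N_C^α` over the incidence algebra. -/
abbrev AntichainQuotient (α : L) (C : Set L) : Type (max u v) :=
  projIdeal k α ⧸ (antichainIdeal k α C).submoduleOf (projIdeal k α)

/-- The antichain module `M_C^α` in the category of finitely generated (equivalently,
finite dimensional) left modules over the incidence algebra. -/
noncomputable def antichainModule (α : L) (C : Set L) :
    FGModuleCat.{max u v} (IncidenceAlgebra k L) :=
  FGModuleCat.of (IncidenceAlgebra k L) (AntichainQuotient k α C)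

/-- The interval module of `[a, b]` (for `a ≤ b`): the antichain module below `b` of the antichain
formed by the maximal elements of the set of all `x < b` with `a ≰ x`. -/
noncomputable def intervalModule (a b : L) : FGModuleCat.{max u v} (IncidenceAlgebra k L) :=
  antichainModule k b {c | Maximal (fun x => x < b ∧ ¬ a ≤ x) c}

end Algebra

/-! ### Boolean antichains -/

section Antichains

variable {L : Type v} [Lattice L] [DecidableEq L]

/-- The meet `⋀ S` of a finite set `S` of elements below `α`, computed in the lattice of all
elements `≤ α`; in particular the empty meet is `α`. -/
def meetBelow (α : L) (S : Finset L) : L :=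
  (insert α S).inf' (Finset.insert_nonempty α S) id

/-- `C` is a boolean antichain below `α`: an antichain of elements `≤ α` which is inclusive and
intersective. -/
structure IsBooleanAntichainBelow (α : L) (C : Finset L) : Prop where
  antichain : IsAntichain (· ≤ ·) (C : Set L)
  below : ∀ c ∈ C, c ≤ α
  inclusive : ∀ S ⊆ C, ∀ S' ⊆ C, meetBelow α S ≤ meetBelow α S' → S' ⊆ S
  intersective : ∀ S ⊆ C, ∀ S' ⊆ C,
    meetBelow α S ⊔ meetBelow α S' = meetBelow α (S ∩ S')

end Antichains

/-! ### Modules as objects of the bounded derived category -/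

section Derived

variable {𝒞 : Type u} [Category.{v} 𝒞] [Abelian 𝒞] [HasDerivedCategory.{w} 𝒞]

/-- An object of an abelian category, as an object of its bounded derived category: the complex
which is concentrated in degree `0`. -/
noncomputable def toBounded (X : 𝒞) : DerivedCategory.Bounded 𝒞 :=
  ⟨(DerivedCategory.singleFunctor 𝒞 0).obj X, ⟨0, inferInstance⟩, ⟨0, inferInstance⟩⟩

end Derived

end LatticeIncidence

/-! Write `M(β, T)` (`meetModule`) for `P_β` modulo its part below the elements of `T`; thus `M_C^α
= M(α, C)`. The sequences `0 → M(β ⊓ t, T) → M(β, T) → M(β, T ∪ {t}) → 0` iterate to a Koszul-type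
resolution of `M(α, C)` by the projectives `P_{⋀S}`, `S ⊆ C`. As `Hom(P_γ, [a, b])` is `k` for `a ≤
γ ≤ b` and `0` otherwise, the derived Homs come from a complex with basis the `S` such that `a ≤ ⋀S
≤ b`. For `a ≤ α` the first inequality means `S ⊆ C_a = {c ∈ C | a ≤ c}`. The `S` with `⋀S ≤ b` are
closed under supersets and, by intersectivity, under intersections, so if any exist they are the
supersets of a least one, `S₀`. The basis is thus empty or the Boolean interval from `S₀` to `C_a`:
the complex is acyclic unless `S₀ = C_a`, and then it is a line in degree `|S₀|`.

`MeetClosed.almostOrthogonal` runs this as an induction that removes one `t` from `T`. If `a ≰ t`,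
the left term is orthogonal to `[a, b]` and the degree is kept; if `t ∈ S₀`, the middle term is
orthogonal and the degree rises by one. What remains is `T = ∅`, a projective, or one of the three
`derivedOrthogonal_of_…` vanishing lemmas of the last section. -/

namespace LatticeIncidence

/-! ### Spaces of dimension at most one -/

/-- Any vector of `V` is a multiple of any given nonzero vector. -/
def AtMostLine (k : Type*) (V : Type*) [Field k] [AddCommGroup V] [Module k V] : Prop :=
  ∀ v : V, v ≠ 0 → ∀ w : V, ∃ c : k, c • v = w

section AtMostLine

variable {k V W : Type*} [Field k] [AddCommGroup V] [Module k V] [AddCommGroup W] [Module k W]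

lemma AtMostLine.of_injective (h : AtMostLine k W) (f : V →ₗ[k] W) (hf : Function.Injective f) :
    AtMostLine k V := by
  intro v hv w
  obtain ⟨c, hc⟩ := h (f v) (fun h0 => hv (hf (by rw [h0, map_zero]))) (f w)
  exact ⟨c, hf (by rw [map_smul, hc])⟩

lemma AtMostLine.of_surjective (h : AtMostLine k V) (f : V →ₗ[k] W) (hf : Function.Surjective f) :
    AtMostLine k W := by
  intro v hv w
  obtain ⟨v, rfl⟩ := hf v
  obtain ⟨w, rfl⟩ := hf w
  obtain ⟨c, rfl⟩ := h v (fun h0 => hv (by rw [h0, map_zero])) w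
  exact ⟨c, (map_smul f c v).symm⟩

lemma AtMostLine.finrank_eq_one (h : AtMostLine k V) [Nontrivial V] : Module.finrank k V = 1 := by
  obtain ⟨v, hv⟩ := exists_ne (0 : V)
  exact _root_.finrank_eq_one v hv (h v hv)

end AtMostLine

/-! ### Homs between shifts of objects in the derived category -/

section Shift

variable {𝒟 : Type*} [Category* 𝒟] [HasShift 𝒟 ℤ]

/-- Fullness of the shift. It desuspends the maps out of `X₁[1]` that arise from a distinguished
triangle. -/
lemma exists_shift_map_comp_eq {X Y : 𝒟} {q p : ℤ} (h : q + 1 = p) (f : X⟦(1 : ℤ)⟧ ⟶ Y⟦p⟧) :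
    ∃ g : X ⟶ Y⟦q⟧, g⟦(1 : ℤ)⟧' ≫ (shiftFunctorAdd' 𝒟 q 1 p h).inv.app Y = f := by
  obtain ⟨g, hg⟩ := (shiftFunctor 𝒟 (1 : ℤ)).map_surjective
    (f ≫ (shiftFunctorAdd' 𝒟 q 1 p h).hom.app Y)
  exact ⟨g, by rw [hg, Category.assoc, Iso.hom_inv_id_app, Category.comp_id]⟩

variable {k : Type*} [Field k] [Preadditive 𝒟] [Linear k 𝒟] [∀ n : ℤ, (shiftFunctor 𝒟 n).Additive]
  [∀ n : ℤ, (shiftFunctor 𝒟 n).Linear k]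

variable (k) in
/-- Shifting by one, as a linear map between Hom spaces. -/
noncomputable def shiftHom (X Y : 𝒟) (q p : ℤ) (h : q + 1 = p) :
    (X ⟶ Y⟦q⟧) →ₗ[k] (X⟦(1 : ℤ)⟧ ⟶ Y⟦p⟧) :=
  (Linear.rightComp k _ ((shiftFunctorAdd' 𝒟 q 1 p h).inv.app Y)).comp
    ((shiftFunctor 𝒟 (1 : ℤ)).mapLinearMap k)

end Shift

/-! ### Orthogonality in the derived category -/

section Derived

variable {k : Type*} [Field k] {𝒞 : Type u} [Category.{v} 𝒞] [Abelian 𝒞]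
  [HasDerivedCategory.{w} 𝒞]

/-- The space of maps from `X` to `Y[p]` in the derived category. -/
abbrev DerivedHom (X Y : 𝒞) (p : ℤ) : Type w :=
  (DerivedCategory.singleFunctor 𝒞 0).obj X ⟶ ((DerivedCategory.singleFunctor 𝒞 0).obj Y)⟦p⟧

/-- All maps from `X` to shifts of `Y` in the derived category vanish. -/
def DerivedOrthogonal (X Y : 𝒞) : Prop :=
  ∀ (p : ℤ) (f : DerivedHom X Y p), f = 0

variable (k) in
/-- At most one shift of `Y` receives nonzero maps from `X` in the derived category, and these
maps form a space of dimension at most one. -/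
def AlmostOrthogonal [Linear k 𝒞] (X Y : 𝒞) : Prop :=
  ∃ d : ℤ, (∀ p, p ≠ d → ∀ f : DerivedHom X Y p, f = 0) ∧ AtMostLine k (DerivedHom X Y d)

lemma DerivedOrthogonal.almostOrthogonal [Linear k 𝒞] {X Y : 𝒞} (h : DerivedOrthogonal X Y) :
    AlmostOrthogonal k X Y :=
  ⟨0, fun p _ => h p, fun v hv => absurd (h 0 v) hv⟩

section ShortExact

variable {S : ShortComplex 𝒞} (hS : S.ShortExact) {Y : 𝒞}
include hS

/-- Exactness of the long exact sequence at `Hom(X₃, Y[p])`, with the connecting map taken from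
`Hom(X₁, Y[q])`. -/
lemma exists_singleδ_comp {q p : ℤ} (h : q + 1 = p) (f : DerivedHom S.X₃ Y p)
    (hf : (DerivedCategory.singleFunctor 𝒞 0).map S.g ≫ f = 0) :
    ∃ g : DerivedHom S.X₁ Y q,
      f = hS.singleδ ≫ g⟦(1 : ℤ)⟧' ≫ (shiftFunctorAdd' _ q 1 p h).inv.app _ := by
  obtain ⟨g, hg⟩ := Pretriangulated.Triangle.yoneda_exact₃ _ hS.singleTriangle_distinguished f hf
  obtain ⟨g', rfl⟩ := exists_shift_map_comp_eq h g
  exact ⟨g', hg⟩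

lemma eq_zero_of_comp_eq_zero (h₁ : DerivedOrthogonal S.X₁ Y) {p : ℤ} (f : DerivedHom S.X₃ Y p)
    (hf : (DerivedCategory.singleFunctor 𝒞 0).map S.g ≫ f = 0) : f = 0 := by
  obtain ⟨g, rfl⟩ := exists_singleδ_comp hS (sub_add_cancel p 1) f hf
  rw [h₁ _ g, Functor.map_zero, Limits.zero_comp, Limits.comp_zero]

lemma DerivedOrthogonal.of_shortExact (h₁ : DerivedOrthogonal S.X₁ Y)
    (h₂ : DerivedOrthogonal S.X₂ Y) : DerivedOrthogonal S.X₃ Y :=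
  fun p f => eq_zero_of_comp_eq_zero hS h₁ f (h₂ p _)

variable [Linear k 𝒞]

/-- Precomposition with `S.g` is injective in every degree, so the degree `d` is kept. -/
lemma AlmostOrthogonal.of_shortExact_of_middle (h₁ : DerivedOrthogonal S.X₁ Y)
    (h₂ : AlmostOrthogonal k S.X₂ Y) : AlmostOrthogonal k S.X₃ Y := by
  obtain ⟨d, hd, hl⟩ := h₂
  refine ⟨d, fun p hp f => eq_zero_of_comp_eq_zero hS h₁ f (hd p hp _),
    hl.of_injective (Linear.leftComp k _ ((DerivedCategory.singleFunctor 𝒞 0).map S.g)) ?_⟩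
  rw [injective_iff_map_eq_zero]
  exact fun f hf => eq_zero_of_comp_eq_zero hS h₁ f hf

/-- The connecting map from degree `p - 1` to degree `p` is surjective, so the degree rises by one.
-/
lemma AlmostOrthogonal.of_shortExact_of_left (h₂ : DerivedOrthogonal S.X₂ Y)
    (h₁ : AlmostOrthogonal k S.X₁ Y) : AlmostOrthogonal k S.X₃ Y := by
  obtain ⟨d, hd, hl⟩ := h₁
  refine ⟨d + 1, fun p hp f => ?_, hl.of_surjective
    ((Linear.leftComp k _ hS.singleδ).comp (shiftHom k _ _ d (d + 1) rfl)) fun f => ?_⟩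
  · obtain ⟨g, rfl⟩ := exists_singleδ_comp hS (sub_add_cancel p 1) f (h₂ p _)
    rw [hd _ (by omega) g, Functor.map_zero, Limits.zero_comp, Limits.comp_zero]
  · obtain ⟨g, hg⟩ := exists_singleδ_comp hS rfl f (h₂ _ _)
    exact ⟨g, hg.symm⟩

end ShortExact

/-! ### Maps out of projective objects -/

section Projective

/-- Negative degrees vanish by the t-structure, positive ones because they are Ext groups out of a
projective. -/
lemma derivedHom_eq_zero_of_projective {P Y : 𝒞} [Projective P] {p : ℤ} (hp : p ≠ 0)
    (f : DerivedHom P Y p) : f = 0 := by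
  rcases lt_or_gt_of_ne hp with h | h
  · have hY : (DerivedCategory.TStructure.t (C := 𝒞)).IsGE
        (((DerivedCategory.singleFunctor 𝒞 0).obj Y)⟦p⟧) (-p) :=
      DerivedCategory.TStructure.t.isGE_shift _ 0 p (-p) (by omega)
    exact DerivedCategory.TStructure.t.zero_of_isLE_of_isGE f 0 (-p) (by omega) inferInstance hY
  · have : HasExt.{w} 𝒞 := hasExt_of_hasDerivedCategory 𝒞
    obtain ⟨n, rfl⟩ : ∃ n : ℕ, ((n + 1 : ℕ) : ℤ) = p := ⟨(p - 1).toNat, by omega⟩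
    obtain ⟨e, rfl⟩ := (Abelian.Ext.homEquiv (X := P) (Y := Y) (n := n + 1)).surjective f
    rw [Abelian.Ext.eq_zero_of_projective e]
    exact Abelian.Ext.zero_hom _ _ _

/-- A morphism of `𝒞`, as a map of degree `0` in the derived category. -/
noncomputable def derivedHomOfHom {X Y : 𝒞} (f : X ⟶ Y) : DerivedHom X Y 0 :=
  (DerivedCategory.singleFunctor 𝒞 0).map f ≫ (shiftFunctorZero _ ℤ).inv.app
    ((DerivedCategory.singleFunctor 𝒞 0).obj Y)

lemma exists_derivedHomOfHom_eq {X Y : 𝒞} (f : DerivedHom X Y 0) :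
    ∃ g : X ⟶ Y, derivedHomOfHom g = f := by
  obtain ⟨g, hg⟩ := (DerivedCategory.singleFunctor 𝒞 0).map_surjective
    (f ≫ (shiftFunctorZero _ ℤ).hom.app _)
  refine ⟨g, ?_⟩
  rw [derivedHomOfHom, hg, Category.assoc, Iso.hom_inv_id_app]
  exact Category.comp_id f

lemma derivedHomOfHom_zero {X Y : 𝒞} : derivedHomOfHom (0 : X ⟶ Y) = 0 := by
  rw [derivedHomOfHom, Functor.map_zero, Limits.zero_comp]

lemma map_comp_derivedHomOfHom {X Y Z : 𝒞} (f : X ⟶ Y) (g : Y ⟶ Z) :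
    (DerivedCategory.singleFunctor 𝒞 0).map f ≫ derivedHomOfHom g = derivedHomOfHom (f ≫ g) := by
  rw [derivedHomOfHom, derivedHomOfHom, Functor.map_comp, Category.assoc]

lemma derivedOrthogonal_of_projective {P Y : 𝒞} [Projective P] (h : ∀ f : P ⟶ Y, f = 0) :
    DerivedOrthogonal P Y := by
  intro p f
  by_cases hp : p = 0
  · subst hp
    obtain ⟨g, rfl⟩ := exists_derivedHomOfHom_eq f
    rw [h g, derivedHomOfHom_zero]
  · exact derivedHom_eq_zero_of_projective hp f

lemma almostOrthogonal_of_projective [Linear k 𝒞] {P Y : 𝒞} [Projective P]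
    (h : AtMostLine k (P ⟶ Y)) : AlmostOrthogonal k P Y := by
  refine ⟨0, fun p hp f => derivedHom_eq_zero_of_projective hp f, h.of_surjective
    ((Linear.rightComp k _ ((shiftFunctorZero _ ℤ).inv.app
    ((DerivedCategory.singleFunctor 𝒞 0).obj Y))).comp
      ((DerivedCategory.singleFunctor 𝒞 0).mapLinearMap k)) exists_derivedHomOfHom_eq⟩

/-- The cokernel of a monomorphism of projectives is orthogonal to `Y` if all maps to `Y` extend
uniquely along this monomorphism. -/
lemma derivedOrthogonal_of_shortExact_of_projective {S : ShortComplex 𝒞} (hS : S.ShortExact)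
    {Y : 𝒞} [Projective S.X₁] [Projective S.X₂] (hinj : ∀ f : S.X₂ ⟶ Y, S.f ≫ f = 0 → f = 0)
    (hsurj : ∀ f : S.X₁ ⟶ Y, ∃ g : S.X₂ ⟶ Y, S.f ≫ g = f) : DerivedOrthogonal S.X₃ Y := by
  intro p f
  have hf : (DerivedCategory.singleFunctor 𝒞 0).map S.g ≫ f = 0 := by
    by_cases hp : p = 0
    · subst hp
      obtain ⟨g, rfl⟩ := exists_derivedHomOfHom_eq f
      rw [map_comp_derivedHomOfHom, hinj (S.g ≫ g) (by rw [← Category.assoc, S.zero,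
        Limits.zero_comp]), derivedHomOfHom_zero]
    · exact derivedHom_eq_zero_of_projective hp _
  obtain ⟨g, rfl⟩ := exists_singleδ_comp hS (sub_add_cancel p 1) f hf
  -- `g` has degree `p - 1`, so it can be nonzero only for `p = 1`. There it extends along `S.f`,
  -- and `δ` followed by the shift of `S.f` is zero.
  by_cases hp : p = 1
  · subst hp
    obtain ⟨g, rfl⟩ := exists_derivedHomOfHom_eq g
    obtain ⟨g, rfl⟩ := hsurj g
    have h0 := Pretriangulated.comp_distTriang_mor_zero₃₁ _ hS.singleTriangle_distinguished
    rw [← map_comp_derivedHomOfHom, Functor.map_comp, Category.assoc]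
    exact (Category.assoc _ _ _).symm.trans
      ((congrArg (· ≫ _) h0).trans Limits.zero_comp)
  · rw [derivedHom_eq_zero_of_projective (by omega) g, Functor.map_zero, Limits.zero_comp,
      Limits.comp_zero]

end Projective

/-! ### Passage to the bounded derived category -/

section Bounded

variable [Linear k 𝒞]

/-- Maps in the bounded derived category, as maps in the derived category. -/
noncomputable def boundedHom (X Y : 𝒞) (p : ℤ) :
    (toBounded X ⟶ (toBounded Y)⟦p⟧) →ₗ[k] DerivedHom X Y p :=
  (Linear.rightComp k _ ((DerivedCategory.Bounded.ι.commShiftIso p).hom.app (toBounded Y))).comp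
    (DerivedCategory.Bounded.ι.mapLinearMap k)

lemma boundedHom_injective (X Y : 𝒞) (p : ℤ) : Function.Injective (boundedHom (k := k) X Y p) :=
  fun _ _ h => DerivedCategory.Bounded.ι.map_injective
    ((cancel_mono ((DerivedCategory.Bounded.ι.commShiftIso p).hom.app (toBounded Y))).1 h)

lemma AlmostOrthogonal.bounded {X Y : 𝒞} (h : AlmostOrthogonal k X Y) :
    (∀ p q : ℤ, Nontrivial (toBounded X ⟶ (toBounded Y)⟦p⟧) →
      Nontrivial (toBounded X ⟶ (toBounded Y)⟦q⟧) → p = q) ∧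
    ∀ p : ℤ, Nontrivial (toBounded X ⟶ (toBounded Y)⟦p⟧) →
      Module.finrank k (toBounded X ⟶ (toBounded Y)⟦p⟧) = 1 := by
  obtain ⟨d, hd, hl⟩ := h
  have key : ∀ p : ℤ, Nontrivial (toBounded X ⟶ (toBounded Y)⟦p⟧) → p = d := by
    intro p hp
    by_contra hpd
    obtain ⟨f, hf⟩ := exists_ne (0 : toBounded X ⟶ (toBounded Y)⟦p⟧)
    exact hf (boundedHom_injective (k := k) X Y p ((hd p hpd _).trans (map_zero _).symm))
  refine ⟨fun p q hp hq => (key p hp).trans (key q hq).symm, fun p hp => ?_⟩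
  obtain rfl := key p hp
  exact (hl.of_injective _ (boundedHom_injective X Y p)).finrank_eq_one

end Bounded

end Derived

section Algebra

variable (k : Type u) [Field k] {L : Type v} [Lattice L] [Finite L] [DecidableEq L]
  [LocallyFiniteOrder L]

/-! ### Multiplication by basis elements -/

omit [Finite L] [LocallyFiniteOrder L] in
lemma basisElt_apply {x y : L} (h : x ≤ y) (a b : L) :
    basisElt k x y h a b = if a = x ∧ b = y then 1 else 0 := rfl

omit [Finite L] in
lemma mul_basisElt_apply (f : IncidenceAlgebra k L) {x y : L} (h : x ≤ y) (a b : L) :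
    (f * basisElt k x y h) a b = if b = y then f a x else 0 := by
  rw [IncidenceAlgebra.mul_apply]
  split_ifs with hb
  · subst hb
    by_cases hax : a ≤ x
    · rw [Finset.sum_eq_single_of_mem x (Finset.mem_Icc.2 ⟨hax, h⟩)]
      · simp [basisElt_apply]
      · intro c _ hc
        simp [basisElt_apply, hc]
    · rw [IncidenceAlgebra.apply_eq_zero_of_not_le hax, Finset.sum_eq_zero]
      intro c hc
      have : c ≠ x := by rintro rfl; exact hax (Finset.mem_Icc.1 hc).1
      simp [basisElt_apply, this]
  · exact Finset.sum_eq_zero fun c _ => by simp [basisElt_apply, hb]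

omit [Finite L] in
lemma basisElt_mul_apply (f : IncidenceAlgebra k L) {x y : L} (h : x ≤ y) (a b : L) :
    (basisElt k x y h * f) a b = if a = x then f y b else 0 := by
  rw [IncidenceAlgebra.mul_apply]
  split_ifs with ha
  · subst ha
    by_cases hyb : y ≤ b
    · rw [Finset.sum_eq_single_of_mem y (Finset.mem_Icc.2 ⟨h, hyb⟩)]
      · simp [basisElt_apply]
      · intro c _ hc
        simp [basisElt_apply, hc]
    · rw [IncidenceAlgebra.apply_eq_zero_of_not_le hyb, Finset.sum_eq_zero]
      intro c hc
      have : c ≠ y := by rintro rfl; exact hyb (Finset.mem_Icc.1 hc).2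
      simp [basisElt_apply, this]
  · exact Finset.sum_eq_zero fun c _ => by simp [basisElt_apply, ha]

omit [Finite L] in
lemma basisElt_mul_basisElt {x y z : L} (h : x ≤ y) (h' : y ≤ z) :
    basisElt k x y h * basisElt k y z h' = basisElt k x z (h.trans h') := by
  ext a b _
  rw [mul_basisElt_apply, basisElt_apply, basisElt_apply]
  split_ifs <;> simp_all

/-! ### Membership in the ideals -/

omit [Finite L] in
lemma mem_projIdeal {α : L} {f : IncidenceAlgebra k L} :
    f ∈ projIdeal k α ↔ f * basisElt k α α le_rfl = f := by
  rw [projIdeal, Ideal.mem_span_singleton']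
  constructor
  · rintro ⟨g, rfl⟩
    rw [mul_assoc, basisElt_mul_basisElt]
  · intro h
    exact ⟨f, h⟩

omit [Finite L] in
lemma apply_of_mem_projIdeal {α : L} {f : IncidenceAlgebra k L} (hf : f ∈ projIdeal k α)
    {x y : L} (hy : y ≠ α) : f x y = 0 := by
  rw [mem_projIdeal] at hf
  rw [← hf, mul_basisElt_apply, if_neg hy]

omit [Finite L] in
lemma mul_basisElt_mem_projIdeal (f : IncidenceAlgebra k L) {x y : L} (h : x ≤ y) :
    f * basisElt k x y h ∈ projIdeal k y := by
  rw [mem_projIdeal, mul_assoc, basisElt_mul_basisElt]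

/-- The ideal is spanned by basis pairs, so membership is a condition on the support; all later
kernels are computed through it. -/
lemma mem_antichainIdeal {α : L} {C : Set L} {f : IncidenceAlgebra k L} :
    f ∈ antichainIdeal k α C ↔
      ∀ x y, f x y ≠ 0 → y = α ∧ ∃ c ∈ C, c ≤ α ∧ x ≤ c := by
  classical
  constructor
  · intro hf
    induction hf using Submodule.span_induction with
    | mem f hf =>
      obtain ⟨c, hc, hcα, rfl⟩ := hf
      intro x y hxy
      rw [basisElt_apply] at hxy
      obtain ⟨rfl, rfl⟩ : x = c ∧ y = α := by
        by_contra h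
        exact hxy (if_neg h)
      exact ⟨rfl, x, hc, hcα, le_rfl⟩
    | zero => exact fun x y h => absurd rfl h
    | add f g _ _ hf hg =>
      intro x y hxy
      by_cases h : f x y = 0
      · exact hg x y (by simpa [h] using hxy)
      · exact hf x y h
    | smul g f _ hf =>
      intro x y hxy
      rw [smul_eq_mul, IncidenceAlgebra.mul_apply] at hxy
      obtain ⟨z, hz, hz0⟩ := Finset.exists_ne_zero_of_sum_ne_zero hxy
      obtain ⟨hy, c, hc, hcα, hzc⟩ := hf z y (right_ne_zero_of_mul hz0)
      exact ⟨hy, c, hc, hcα, (Finset.mem_Icc.1 hz).1.trans hzc⟩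
  · intro hf
    have := Fintype.ofFinite L
    have key : f = ∑ x : L, if h : x ≤ α then f x α • basisElt k x α h else 0 := by
      ext a b hab
      have hev : ∀ g : L → IncidenceAlgebra k L, (∑ x, g x) a b = ∑ x, g x a b := fun g =>
        map_sum (⟨⟨fun f : IncidenceAlgebra k L => f a b, rfl⟩, fun _ _ => rfl⟩ :
          IncidenceAlgebra k L →+ k) g _
      rw [hev, Finset.sum_eq_single a]
      · by_cases hb : b = α
        · subst hb
          simp [hab, basisElt_apply]
        · have : f a b = 0 := by
            by_contra h
            exact hb (hf a b h).1
          split_ifs <;> simp [basisElt_apply, hb, this]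
      · intro x _ hx
        split_ifs <;> simp [basisElt_apply, hx.symm]
      · simp
    rw [key]
    refine Submodule.sum_mem _ fun x _ => ?_
    split_ifs with h
    · by_cases h0 : f x α = 0
      · rw [h0, zero_smul]
        exact Submodule.zero_mem _
      · obtain ⟨-, c, hc, hcα, hxc⟩ := hf x α h0
        have : f x α • basisElt k x α h = (f x α • basisElt k x c hxc) * basisElt k c α hcα := by
          rw [smul_mul_assoc, basisElt_mul_basisElt]
        rw [this]
        exact Ideal.mul_mem_left _ _ (Submodule.subset_span ⟨c, hc, hcα, rfl⟩)
    · exact Submodule.zero_mem _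

end Algebra

/-! ### Short exact sequences and projectives among finitely generated modules -/

section FGModule

variable {R : Type u} [Ring R] [IsNoetherianRing R]

lemma shortExact_of_exact_hom (S : ShortComplex (FGModuleCat.{v} R))
    (hf : Function.Injective S.f.hom.hom) (hg : Function.Surjective S.g.hom.hom)
    (h : Function.Exact S.f.hom.hom S.g.hom.hom) : S.ShortExact := by
  let F := forget₂ (FGModuleCat.{v} R) (ModuleCat.{v} R)
  have : F.Additive := inferInstanceAs (ModuleCat.isFG R).ι.Additive
  refine ShortComplex.ShortExact.mk' ?_ ?_ ?_
  · rw [← ShortComplex.exact_map_iff_of_faithful _ F,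
      ShortComplex.ShortExact.moduleCat_exact_iff_function_exact]
    exact h
  · exact F.mono_of_mono_map ((ModuleCat.mono_iff_injective _).2 hf)
  · exact F.epi_of_epi_map ((ModuleCat.epi_iff_surjective _).2 hg)

lemma projective_of_lifting (P : FGModuleCat.{v} R)
    (h : ∀ (E X : FGModuleCat.{v} R) (f : P →ₗ[R] X) (g : E →ₗ[R] X),
      Function.Surjective g → ∃ l : P →ₗ[R] E, g ∘ₗ l = f) : Projective P where
  factors {E X} f g _ := by
    let F := forget₂ (FGModuleCat.{v} R) (ModuleCat.{v} R)
    have hg : Function.Surjective g.hom.hom :=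
      (ModuleCat.epi_iff_surjective (F.map g)).1 inferInstance
    obtain ⟨l, hl⟩ := h E X f.hom.hom g.hom.hom hg
    exact ⟨FGModuleCat.ofHom l, FGModuleCat.hom_ext hl⟩

end FGModule

section Algebra

variable (k : Type u) [Field k] {L : Type v} [Lattice L] [Finite L] [DecidableEq L]
  [LocallyFiniteOrder L]

/-! ### The generator of an antichain module -/

/-- The class of `(x, α)` in the antichain module below `α`. -/
def quotBasis (α : L) (C : Set L) (x : L) (h : x ≤ α) : AntichainQuotient k α C :=
  Submodule.Quotient.mk ⟨basisElt k x α h, by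
    rw [mem_projIdeal, basisElt_mul_basisElt]⟩

variable {k} {α β : L} {C D : Set L}

omit [Finite L] in
lemma mk_eq_smul_quotBasis (f : projIdeal k α) :
    (Submodule.Quotient.mk f : AntichainQuotient k α C) =
      (f : IncidenceAlgebra k L) • quotBasis k α C α le_rfl := by
  rw [quotBasis, ← Submodule.Quotient.mk_smul]
  exact congrArg _ (Subtype.ext ((mem_projIdeal k).1 f.2).symm)

omit [Finite L] in
lemma basisElt_smul_quotBasis {x y : L} (h : x ≤ y) (hy : y ≤ α) :
    basisElt k x y h • quotBasis k α C y hy = quotBasis k α C x (h.trans hy) := by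
  rw [quotBasis, ← Submodule.Quotient.mk_smul]
  exact congrArg _ (Subtype.ext (basisElt_mul_basisElt k h hy))

omit [Finite L] in
lemma linearMap_ext_of_quotBasis {N : Type*} [AddCommGroup N] [Module (IncidenceAlgebra k L) N]
    {f g : AntichainQuotient k α C →ₗ[IncidenceAlgebra k L] N}
    (h : f (quotBasis k α C α le_rfl) = g (quotBasis k α C α le_rfl)) : f = g := by
  refine LinearMap.ext fun x => ?_
  obtain ⟨x, rfl⟩ := Submodule.Quotient.mk_surjective _ x
  rw [mk_eq_smul_quotBasis, map_smul, map_smul, h]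

omit [Finite L] in
lemma map_quotBasis {N : Type*} [AddCommGroup N] [Module (IncidenceAlgebra k L) N]
    (f : AntichainQuotient k α C →ₗ[IncidenceAlgebra k L] N) :
    basisElt k α α le_rfl • f (quotBasis k α C α le_rfl) = f (quotBasis k α C α le_rfl) := by
  rw [← map_smul, basisElt_smul_quotBasis]

lemma mk_eq_zero_iff {f : projIdeal k α} :
    (Submodule.Quotient.mk f : AntichainQuotient k α C) = 0 ↔
      ∀ x, (f : IncidenceAlgebra k L) x α ≠ 0 → ∃ c ∈ C, c ≤ α ∧ x ≤ c := by
  rw [Submodule.Quotient.mk_eq_zero]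
  refine (mem_antichainIdeal k).trans ⟨fun h x hx => (h x α hx).2, fun h x y hxy => ?_⟩
  obtain rfl : y = α := by
    by_contra hy
    exact hxy (apply_of_mem_projIdeal k f.2 hy)
  exact ⟨rfl, h x hxy⟩

/-- Here the module is `P_α`, whose maps to `N` correspond to the elements of `e_α N`. The equation
`C = ∅` also covers the image of the empty set in `meetModule`. -/
lemma exists_linearMap_of_eq_empty (hC : C = ∅) {N : Type*} [AddCommGroup N]
    [Module (IncidenceAlgebra k L) N] (n : N) (hn : basisElt k α α le_rfl • n = n) :
    ∃ f : AntichainQuotient k α C →ₗ[IncidenceAlgebra k L] N,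
      f (quotBasis k α C α le_rfl) = n := by
  subst hC
  refine ⟨Submodule.liftQ _ ((LinearMap.toSpanSingleton (IncidenceAlgebra k L) N n).comp
    (projIdeal k α).subtype) ?_, hn⟩
  intro f hf
  have h0 : (f : IncidenceAlgebra k L) = 0 := by
    ext x y _
    by_contra hxy
    obtain ⟨-, c, hc, -⟩ := (mem_antichainIdeal k).1 hf x y hxy
    exact hc
  rw [LinearMap.mem_ker]
  simp [h0]

lemma projective_antichainModule (hC : C = ∅) : Projective (antichainModule k α C) :=
  projective_of_lifting _ fun E X f g hg => by
    obtain ⟨y, hy⟩ := hg (f (quotBasis k α C α le_rfl))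
    -- A preimage `y` need not be fixed by the idempotent `(α, α)`, so it is multiplied by it.
    obtain ⟨l, hl⟩ := exists_linearMap_of_eq_empty (α := α) hC (basisElt k α α le_rfl • y)
      (by rw [smul_smul, basisElt_mul_basisElt])
    refine ⟨l, linearMap_ext_of_quotBasis ?_⟩
    refine (congrArg g hl).trans ?_
    rw [map_smul, hy]
    exact map_quotBasis f

/-! ### Right multiplication by basis elements -/

/-- Right multiplication by `(α, β)` on antichain modules. -/
noncomputable def quotMap (h : α ≤ β) (hCD : ∀ c ∈ C, c ≤ α → ∃ d ∈ D, d ≤ β ∧ c ≤ d) :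
    AntichainQuotient k α C →ₗ[IncidenceAlgebra k L] AntichainQuotient k β D :=
  Submodule.mapQ _ _
    ({ toFun := fun f => ⟨f * basisElt k α β h, mul_basisElt_mem_projIdeal k _ h⟩
       map_add' := fun f g => Subtype.ext (add_mul _ _ _)
       map_smul' := fun f g => Subtype.ext (mul_assoc _ _ _) } :
      projIdeal k α →ₗ[IncidenceAlgebra k L] projIdeal k β) (by
    intro f hf
    refine (mem_antichainIdeal k).2 fun x y hxy => ?_
    simp only [Submodule.coe_subtype, LinearMap.coe_mk, AddHom.coe_mk, mul_basisElt_apply] at hxy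
    split_ifs at hxy with hy
    · obtain ⟨-, c, hc, hcα, hxc⟩ := (mem_antichainIdeal k).1 hf x α hxy
      obtain ⟨d, hd, hdβ, hcd⟩ := hCD c hc hcα
      exact ⟨hy, d, hd, hdβ, hxc.trans hcd⟩
    · exact absurd rfl hxy)

lemma quotMap_mk (h : α ≤ β) (hCD : ∀ c ∈ C, c ≤ α → ∃ d ∈ D, d ≤ β ∧ c ≤ d)
    (f : projIdeal k α) :
    quotMap (k := k) h hCD (Submodule.Quotient.mk f) =
      Submodule.Quotient.mk ⟨f * basisElt k α β h, mul_basisElt_mem_projIdeal k _ h⟩ := rfl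

lemma quotMap_quotBasis (h : α ≤ β) (hCD : ∀ c ∈ C, c ≤ α → ∃ d ∈ D, d ≤ β ∧ c ≤ d) :
    quotMap (k := k) h hCD (quotBasis k α C α le_rfl) = quotBasis k β D α h := by
  rw [quotBasis, quotMap_mk]
  exact congrArg _ (Subtype.ext (basisElt_mul_basisElt k le_rfl h))

/-! ### The modules with support the elements below `β` and not below elements of `T` -/

variable (k) in
/-- The antichain module below `β` of the elements `t ⊓ β` for `t ∈ T`. -/
noncomputable abbrev meetModule (β : L) (T : Finset L) :
    FGModuleCat.{max u v} (IncidenceAlgebra k L) :=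
  antichainModule k β ((· ⊓ β) '' (T : Set L))

/-- A nonzero entry at `(x, β)` forces `x ≤ β`, so `x ≤ t ⊓ β` reduces to `x ≤ t`. The criterion on
rows then has the same form for `β` and `β ⊓ t`. -/
lemma mk_eq_zero_iff_of_image {T : Finset L} {f : projIdeal k β} :
    (Submodule.Quotient.mk f : AntichainQuotient k β ((· ⊓ β) '' (T : Set L))) = 0 ↔
      ∀ x, (f : IncidenceAlgebra k L) x β ≠ 0 → ∃ t ∈ T, x ≤ t := by
  rw [mk_eq_zero_iff]
  refine forall₂_congr fun x hx => ⟨?_, ?_⟩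
  · rintro ⟨_, ⟨t, ht, rfl⟩, -, hxt⟩
    exact ⟨t, ht, hxt.trans inf_le_left⟩
  · rintro ⟨t, ht, hxt⟩
    exact ⟨t ⊓ β, ⟨t, ht, rfl⟩, inf_le_right,
      le_inf hxt (IncidenceAlgebra.le_of_ne_zero hx)⟩

/-- Right multiplication by `(β ⊓ t, β)`. -/
noncomputable def meetInclusion (β t : L) (T : Finset L) :
    AntichainQuotient k (β ⊓ t) ((· ⊓ (β ⊓ t)) '' (T : Set L)) →ₗ[IncidenceAlgebra k L]
      AntichainQuotient k β ((· ⊓ β) '' (T : Set L)) :=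
  quotMap inf_le_left (by
    rintro _ ⟨s, hs, rfl⟩ -
    exact ⟨s ⊓ β, ⟨s, hs, rfl⟩, inf_le_right, inf_le_inf_left s inf_le_left⟩)

/-- The projection to the quotient by a further element. -/
noncomputable def meetProjection (β t : L) (T : Finset L) :
    AntichainQuotient k β ((· ⊓ β) '' (T : Set L)) →ₗ[IncidenceAlgebra k L]
      AntichainQuotient k β ((· ⊓ β) '' ((insert t T : Finset L) : Set L)) :=
  quotMap le_rfl (by
    rintro _ ⟨s, hs, rfl⟩ -
    exact ⟨s ⊓ β, ⟨s, Finset.mem_insert_of_mem hs, rfl⟩, inf_le_right, le_rfl⟩)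

lemma meetInclusion_injective (β t : L) (T : Finset L) :
    Function.Injective (meetInclusion (k := k) β t T) := by
  rw [injective_iff_map_eq_zero]
  intro x hx
  obtain ⟨x, rfl⟩ := Submodule.Quotient.mk_surjective _ x
  rw [meetInclusion, quotMap_mk, mk_eq_zero_iff_of_image] at hx
  rw [mk_eq_zero_iff_of_image]
  intro y hy
  exact hx y (by rwa [mul_basisElt_apply, if_pos rfl])

lemma meetProjection_mk (β t : L) (T : Finset L) (x : projIdeal k β) :
    meetProjection β t T (Submodule.Quotient.mk x) = Submodule.Quotient.mk x :=
  congrArg Submodule.Quotient.mk (Subtype.ext ((mem_projIdeal k).1 x.2))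

lemma meetProjection_surjective (β t : L) (T : Finset L) :
    Function.Surjective (meetProjection (k := k) β t T) := by
  intro x
  obtain ⟨x, rfl⟩ := Submodule.Quotient.mk_surjective _ x
  exact ⟨_, meetProjection_mk β t T x⟩

lemma exact_meetInclusion_meetProjection (β t : L) (T : Finset L) :
    Function.Exact (meetInclusion (k := k) β t T) (meetProjection β t T) := by
  classical
  intro x
  obtain ⟨x, rfl⟩ := Submodule.Quotient.mk_surjective _ x
  rw [meetProjection_mk, mk_eq_zero_iff_of_image]
  constructor
  · intro hx
    -- The rows `y ≤ t` of the column `β` of `x`, moved to the column `β ⊓ t`. What is left of `x`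
    -- lies in rows `y ≰ t`, hence below elements of `T`.
    let z : IncidenceAlgebra k L :=
      ⟨fun y c => if c = β ⊓ t ∧ y ≤ t then (x : IncidenceAlgebra k L) y β else 0, by
        intro y c hyc
        rw [ite_eq_right_iff]
        rintro ⟨rfl, hyt⟩
        refine IncidenceAlgebra.apply_eq_zero_of_not_le (fun hyβ => ?_) _
        exact hyc (le_inf hyβ hyt)⟩
    have hz : ∀ y c, z y c =
      if c = β ⊓ t ∧ y ≤ t then (x : IncidenceAlgebra k L) y β else 0 := fun _ _ => rfl
    have hzP : z ∈ projIdeal k (β ⊓ t) := by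
      rw [mem_projIdeal]
      ext y c _
      rw [mul_basisElt_apply, hz, hz]
      split_ifs <;> simp_all
    refine ⟨Submodule.Quotient.mk ⟨z, hzP⟩, ?_⟩
    rw [meetInclusion, quotMap_mk, ← sub_eq_zero, ← Submodule.Quotient.mk_sub, mk_eq_zero_iff_of_image]
    intro y hy
    rw [Submodule.coe_sub, IncidenceAlgebra.sub_apply, mul_basisElt_apply, if_pos rfl, hz]
      at hy
    by_cases hyt : y ≤ t
    · simp [hyt] at hy
    · obtain ⟨s, hs, hys⟩ := hx y (by simpa [hyt] using hy)
      rcases Finset.mem_insert.1 hs with rfl | hs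
      · exact absurd hys hyt
      · exact ⟨s, hs, hys⟩
  · rintro ⟨z, hz⟩ y hy
    obtain ⟨z, rfl⟩ := Submodule.Quotient.mk_surjective _ z
    rw [meetInclusion, quotMap_mk, ← sub_eq_zero, ← Submodule.Quotient.mk_sub, mk_eq_zero_iff_of_image] at hz
    by_cases hyt : y ≤ t
    · exact ⟨t, Finset.mem_insert_self t T, hyt⟩
    -- The column of `z` vanishes in rows not below `t`, so there the difference is `-x`.
    · obtain ⟨s, hs, hys⟩ := hz y (by
        rw [Submodule.coe_sub, IncidenceAlgebra.sub_apply, mul_basisElt_apply, if_pos rfl,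
          IncidenceAlgebra.apply_eq_zero_of_not_le (fun h => hyt (h.trans inf_le_right)),
          zero_sub]
        exact neg_ne_zero.2 hy)
      exact ⟨s, Finset.mem_insert_of_mem hs, hys⟩

/-- The sequence which expresses the passage from `T` to `insert t T`. -/
noncomputable abbrev meetShortComplex (β t : L) (T : Finset L) :
    ShortComplex (FGModuleCat.{max u v} (IncidenceAlgebra k L)) where
  X₁ := meetModule k (β ⊓ t) T
  X₂ := meetModule k β T
  X₃ := meetModule k β (insert t T)
  f := FGModuleCat.ofHom (meetInclusion β t T)
  g := FGModuleCat.ofHom (meetProjection β t T)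
  zero := FGModuleCat.hom_ext (LinearMap.ext fun x =>
    (exact_meetInclusion_meetProjection β t T).apply_apply_eq_zero x)

lemma meetShortComplex_shortExact (β t : L) (T : Finset L) :
    (meetShortComplex (k := k) β t T).ShortExact :=
  shortExact_of_exact_hom (meetShortComplex (k := k) β t T) (meetInclusion_injective β t T)
    (meetProjection_surjective β t T) (exact_meetInclusion_meetProjection β t T)

/-! ### Maps to interval modules -/

lemma basisElt_smul_eq_zero (hβ : ¬ β ≤ α) (x : AntichainQuotient k α C) :
    basisElt k β β le_rfl • x = 0 := by
  obtain ⟨x, rfl⟩ := Submodule.Quotient.mk_surjective _ x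
  rw [← Submodule.Quotient.mk_smul, mk_eq_zero_iff]
  intro y hy
  refine absurd ?_ hy
  refine (basisElt_mul_apply k (x : IncidenceAlgebra k L) le_rfl y α).trans ?_
  rw [IncidenceAlgebra.apply_eq_zero_of_not_le hβ, ite_self]

omit [Finite L] in
-- Multiplication by `(β, β)` keeps only row `β`, and elements of `P_α` live in column `α`: one
-- entry survives. All the dimension bounds come from this.
lemma exists_basisElt_smul_eq (hβ : β ≤ α) (x : AntichainQuotient k α C) :
    ∃ c : k, basisElt k β β le_rfl • x =
      algebraMap k (IncidenceAlgebra k L) c • quotBasis k α C β hβ := by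
  obtain ⟨x, rfl⟩ := Submodule.Quotient.mk_surjective _ x
  refine ⟨(x : IncidenceAlgebra k L) β α, ?_⟩
  rw [quotBasis, ← Submodule.Quotient.mk_smul, ← Submodule.Quotient.mk_smul]
  refine congrArg _ (Subtype.ext ?_)
  change basisElt k β β le_rfl * (x : IncidenceAlgebra k L) =
    algebraMap k _ _ * basisElt k β α hβ
  rw [← Algebra.smul_def]
  ext y z _
  rw [basisElt_mul_apply, IncidenceAlgebra.constSMul_apply, basisElt_apply]
  by_cases hz : z = α
  · subst hz
    by_cases hy : y = β <;> simp [hy]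
  · rw [apply_of_mem_projIdeal k x.2 hz]
    simp [hz]

variable {a b : L}

/-- The maximal elements of the set of all `x < b` with `a ≰ x`. -/
abbrev intervalAntichain (a b : L) : Set L := {c | Maximal (fun x => x < b ∧ ¬ a ≤ x) c}

omit [DecidableEq L] [LocallyFiniteOrder L] in
-- By finiteness, every `x < b` with `a ≰ x` lies below a maximal such element. Hence the interval
-- module is supported on `[a, b]`.
lemma exists_mem_intervalAntichain_iff (hab : a ≤ b) {x : L} (hx : x ≤ b) :
    (∃ c ∈ intervalAntichain a b, c ≤ b ∧ x ≤ c) ↔ ¬ a ≤ x := by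
  constructor
  · rintro ⟨c, hc : Maximal (fun x => x < b ∧ ¬ a ≤ x) c, -, hxc⟩ hax
    exact hc.prop.2 (hax.trans hxc)
  · intro hax
    have hxb : x < b := lt_of_le_of_ne hx (by rintro rfl; exact hax hab)
    obtain ⟨c, hxc, hc⟩ :=
      (Set.toFinite {x | x < b ∧ ¬ a ≤ x}).exists_le_maximal (a := x) ⟨hxb, hax⟩
    exact ⟨c, hc, hc.prop.1.le, hxc⟩

lemma smul_quotBasis_intervalAntichain_eq_zero (hab : a ≤ b) (hβ : β ≤ b) {c : k}
    (h : c = 0 ∨ ¬ a ≤ β) :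
    algebraMap k (IncidenceAlgebra k L) c • quotBasis k b (intervalAntichain a b) β hβ = 0 := by
  rcases h with rfl | h
  · rw [map_zero, zero_smul]
  · convert smul_zero _
    rw [quotBasis, mk_eq_zero_iff]
    intro x hx
    change basisElt k β b hβ x b ≠ 0 at hx
    have : x = β := by
      by_contra hxβ
      simp [basisElt_apply, hxβ] at hx
    subst this
    exact (exists_mem_intervalAntichain_iff hab hβ).2 h

lemma eq_zero_of_smul_quotBasis_eq_zero (haβ : a ≤ β) (hβ : β ≤ b) {c : k}
    (h : algebraMap k (IncidenceAlgebra k L) c • quotBasis k b (intervalAntichain a b) β hβ = 0) :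
    c = 0 := by
  by_contra hc
  rw [quotBasis, ← Submodule.Quotient.mk_smul, mk_eq_zero_iff] at h
  refine (exists_mem_intervalAntichain_iff (haβ.trans hβ) hβ).1 (h β ?_) haβ
  change (algebraMap k (IncidenceAlgebra k L) c * basisElt k β b hβ) β b ≠ 0
  rw [← Algebra.smul_def, IncidenceAlgebra.constSMul_apply, basisElt_apply]
  simpa using hc

omit [Finite L] in
lemma basisElt_smul_algebraMap_smul_quotBasis {x y : L} (h : x ≤ y) (hy : y ≤ α) (c : k) :
    basisElt k x y h • algebraMap k (IncidenceAlgebra k L) c • quotBasis k α C y hy =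
      algebraMap k (IncidenceAlgebra k L) c • quotBasis k α C x (h.trans hy) := by
  rw [smul_smul, ← Algebra.commutes, ← smul_smul, basisElt_smul_quotBasis]

omit [Finite L] in
lemma exists_map_quotBasis_eq (hβ : β ≤ α)
    (f : AntichainQuotient k β C →ₗ[IncidenceAlgebra k L] AntichainQuotient k α D) :
    ∃ c : k, f (quotBasis k β C β le_rfl) =
      algebraMap k (IncidenceAlgebra k L) c • quotBasis k α D β hβ := by
  rw [← map_quotBasis]
  exact exists_basisElt_smul_eq hβ _

/-- The generator goes to an element fixed by `(β, β)`, and the interval module has no nonzero such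
element for `β` outside `[a, b]`. -/
lemma hom_intervalModule_eq_zero (hab : a ≤ b) (h : ¬ (a ≤ β ∧ β ≤ b))
    (f : antichainModule k β C ⟶ intervalModule k a b) : f = 0 := by
  refine FGModuleCat.hom_ext (linearMap_ext_of_quotBasis ?_)
  by_cases hβ : β ≤ b
  · obtain ⟨c, hc⟩ := exists_map_quotBasis_eq hβ f.hom.hom
    exact hc.trans (smul_quotBasis_intervalAntichain_eq_zero hab hβ
      (Or.inr fun ha => h ⟨ha, hβ⟩))
  · exact (map_quotBasis f.hom.hom).symm.trans (basisElt_smul_eq_zero hβ _)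

lemma atMostLine_hom_intervalModule (hab : a ≤ b) :
    AtMostLine k (antichainModule k β C ⟶ intervalModule k a b) := by
  intro f hf g
  have hβ : β ≤ b := by
    by_contra hβ
    exact hf (hom_intervalModule_eq_zero hab (fun h => hβ h.2) f)
  obtain ⟨c, hc⟩ := exists_map_quotBasis_eq hβ f.hom.hom
  obtain ⟨d, hd⟩ := exists_map_quotBasis_eq hβ g.hom.hom
  have hc0 : c ≠ 0 := by
    rintro rfl
    exact hf (FGModuleCat.hom_ext (linearMap_ext_of_quotBasis
      (hc.trans (smul_quotBasis_intervalAntichain_eq_zero hab hβ (Or.inl rfl)))))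
  refine ⟨d / c, FGModuleCat.hom_ext (linearMap_ext_of_quotBasis ?_)⟩
  refine ((congrArg (algebraMap k (IncidenceAlgebra k L) (d / c) • ·) hc).trans ?_).trans hd.symm
  refine (smul_smul _ _ _).trans ?_
  rw [← map_mul, div_mul_cancel₀ d hc0]
  rfl

instance projective_meetModule_empty (β : L) : Projective (meetModule k β ∅) :=
  projective_antichainModule (by simp)

omit [Finite L] in
lemma map_quotBasis_of_le {N : Type*} [AddCommGroup N] [Module (IncidenceAlgebra k L) N]
    (f : AntichainQuotient k α C →ₗ[IncidenceAlgebra k L] N) (h : β ≤ α) :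
    f (quotBasis k α C β h) = basisElt k β α h • f (quotBasis k α C α le_rfl) := by
  rw [← map_smul, basisElt_smul_quotBasis]

lemma meetInclusion_quotBasis (β t : L) (T : Finset L) :
    meetInclusion (k := k) β t T (quotBasis k _ _ (β ⊓ t) le_rfl) =
      quotBasis k β _ (β ⊓ t) inf_le_left :=
  quotMap_quotBasis _ _

/-- Both `β` and `β ⊓ t` lie in `[a, b]`, so restriction from `Hom(P_β, [a, b])` to `Hom(P_{β ⊓ t},
[a, b])` is an isomorphism of lines. -/
lemma derivedOrthogonal_meetModule_singleton
    [HasDerivedCategory.{w} (FGModuleCat.{max u v} (IncidenceAlgebra k L))]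
    {t : L} (haβ : a ≤ β) (hat : a ≤ t) (hβ : β ≤ b) :
    DerivedOrthogonal (meetModule k β (insert t ∅)) (intervalModule k a b) := by
  have hγ : β ⊓ t ≤ b := inf_le_left.trans hβ
  refine derivedOrthogonal_of_shortExact_of_projective
    (meetShortComplex_shortExact (k := k) β t ∅) (fun f hf => ?_) (fun f => ?_)
  · obtain ⟨c, hc⟩ := exists_map_quotBasis_eq hβ f.hom.hom
    have h0 : f.hom.hom (meetInclusion (k := k) β t ∅ (quotBasis k _ _ _ le_rfl)) = 0 :=
      LinearMap.congr_fun (congrArg (fun g => g.hom.hom) hf) _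
    have h1 := (map_quotBasis_of_le f.hom.hom inf_le_left).symm.trans
      ((congrArg f.hom.hom (meetInclusion_quotBasis β t ∅).symm).trans h0)
    have h2 := (basisElt_smul_algebraMap_smul_quotBasis inf_le_left hβ c).symm.trans
      ((congrArg (basisElt k _ β inf_le_left • ·) hc).symm.trans h1)
    obtain rfl := eq_zero_of_smul_quotBasis_eq_zero (le_inf haβ hat) hγ h2
    exact FGModuleCat.hom_ext (linearMap_ext_of_quotBasis (hc.trans
      (smul_quotBasis_intervalAntichain_eq_zero (haβ.trans hβ) hβ (Or.inl rfl))))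
  · obtain ⟨c, hc⟩ := exists_map_quotBasis_eq hγ f.hom.hom
    obtain ⟨g, hg⟩ := exists_linearMap_of_eq_empty (k := k) (α := β)
      (C := (· ⊓ β) '' ((∅ : Finset L) : Set L)) (by simp)
      (algebraMap k (IncidenceAlgebra k L) c • quotBasis k b (intervalAntichain a b) β hβ)
      (basisElt_smul_algebraMap_smul_quotBasis le_rfl hβ c)
    refine ⟨FGModuleCat.ofHom g, FGModuleCat.hom_ext (linearMap_ext_of_quotBasis ?_)⟩
    refine Eq.trans ?_ hc.symm
    refine (congrArg g (meetInclusion_quotBasis β t ∅)).trans ?_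
    rw [map_quotBasis_of_le, hg, basisElt_smul_algebraMap_smul_quotBasis]

end Algebra

/-! ### Meets below an element -/

section Meet

variable {L : Type v} [Lattice L] [DecidableEq L]

lemma le_meetBelow_iff {x β : L} {S : Finset L} :
    x ≤ meetBelow β S ↔ x ≤ β ∧ ∀ s ∈ S, x ≤ s := by
  simp [meetBelow]

lemma meetBelow_empty (β : L) : meetBelow β ∅ = β := by
  simp [meetBelow]

lemma meetBelow_inf (β t : L) (S : Finset L) :
    meetBelow (β ⊓ t) S = meetBelow β (insert t S) :=
  eq_of_forall_le_iff fun x => by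
    simp only [le_meetBelow_iff, le_inf_iff, Finset.forall_mem_insert, and_assoc]

lemma meetBelow_anti (β : L) {S T : Finset L} (h : S ⊆ T) : meetBelow β T ≤ meetBelow β S :=
  le_meetBelow_iff.2 ⟨(le_meetBelow_iff.1 le_rfl).1,
    fun s hs => (le_meetBelow_iff.1 le_rfl).2 s (h hs)⟩

/-- The subsets of `T` whose meet below `β` is at most `b` are closed under intersection. -/
def MeetClosed (β : L) (T : Finset L) (b : L) : Prop :=
  ∀ S ⊆ T, ∀ S' ⊆ T, meetBelow β S ≤ b → meetBelow β S' ≤ b → meetBelow β (S ∩ S') ≤ b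

variable {β b t : L} {T : Finset L}

lemma MeetClosed.mono (h : MeetClosed β T b) {T' : Finset L} (hT : T' ⊆ T) :
    MeetClosed β T' b :=
  fun S hS S' hS' => h S (hS.trans hT) S' (hS'.trans hT)

lemma MeetClosed.inf (h : MeetClosed β (insert t T) b) : MeetClosed (β ⊓ t) T b := by
  intro S hS S' hS' h1 h2
  rw [meetBelow_inf] at h1 h2 ⊢
  rw [Finset.insert_inter_distrib]
  exact h _ (Finset.insert_subset_insert t hS) _ (Finset.insert_subset_insert t hS') h1 h2

/-- If no element of `T` is needed for the meet of `T` to be at most `b`, then the empty meet is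
at most `b`. -/
lemma MeetClosed.le_of_forall_erase (h : MeetClosed β T b) (hT : meetBelow β T ≤ b)
    (he : ∀ t ∈ T, meetBelow β (T.erase t) ≤ b) : β ≤ b := by
  -- `T \ U` is the intersection of the sets `T.erase t` for `t ∈ U`; the case `U = T` gives the
  -- empty meet.
  have key : ∀ U ⊆ T, meetBelow β (T \ U) ≤ b := by
    intro U
    induction U using Finset.induction_on with
    | empty => exact fun _ => by rwa [Finset.sdiff_empty]
    | insert t U _ ih =>
      intro hU
      have hTU : T \ insert t U = T.erase t ∩ (T \ U) := by
        ext x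
        simp only [Finset.mem_sdiff, Finset.mem_insert, Finset.mem_inter, Finset.mem_erase]
        tauto
      rw [hTU]
      exact h _ (Finset.erase_subset t T) _ Finset.sdiff_subset
        (he t (hU (Finset.mem_insert_self t U)))
        (ih ((Finset.subset_insert t U).trans hU))
  simpa [meetBelow_empty] using key T subset_rfl

/-- By intersectivity the meet of `S ∩ S'` is the join of two elements that are at most `b`. -/
lemma IsBooleanAntichainBelow.meetClosed {α : L} {C : Finset L}
    (hC : IsBooleanAntichainBelow α C) (b : L) : MeetClosed α C b :=
  fun S hS S' hS' h h' => hC.intersective S hS S' hS' ▸ sup_le h h'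

end Meet

/-! ### Maps from antichain modules to interval modules -/

section Main

variable {k : Type u} [Field k] {L : Type v} [Lattice L] [Finite L] [DecidableEq L]
  [LocallyFiniteOrder L] [HasDerivedCategory.{w} (FGModuleCat.{max u v} (IncidenceAlgebra k L))]
  {a b : L}

/-- No term `P_{⋀S}` of the resolution maps nontrivially to `[a, b]`, since `⋀S ≤ β` is never above
`a`. -/
lemma derivedOrthogonal_of_not_le (hab : a ≤ b) {β : L} (hβ : ¬ a ≤ β) (T : Finset L) :
    DerivedOrthogonal (meetModule k β T) (intervalModule k a b) := by
  induction T using Finset.induction_on generalizing β with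
  | empty =>
    exact derivedOrthogonal_of_projective (hom_intervalModule_eq_zero hab fun h => hβ h.1)
  | insert t T _ ih =>
    exact DerivedOrthogonal.of_shortExact (meetShortComplex_shortExact (k := k) β t T)
      (ih fun h => hβ (h.trans inf_le_left)) (ih hβ)

/-- Each `⋀S` with `S ⊆ T` lies above `⋀T`, so none is at most `b`. -/
lemma derivedOrthogonal_of_meetBelow_not_le (hab : a ≤ b) {β : L} {T : Finset L}
    (hT : ¬ meetBelow β T ≤ b) :
    DerivedOrthogonal (meetModule k β T) (intervalModule k a b) := by
  induction T using Finset.induction_on generalizing β with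
  | empty =>
    rw [meetBelow_empty] at hT
    exact derivedOrthogonal_of_projective (hom_intervalModule_eq_zero hab fun h => hT h.2)
  | insert t T _ ih =>
    refine DerivedOrthogonal.of_shortExact (meetShortComplex_shortExact (k := k) β t T)
      (ih ?_) (ih fun h => hT ((meetBelow_anti β (Finset.subset_insert t T)).trans h))
    rwa [meetBelow_inf]

/-- Every subset of `T` contributes a line, and the complex of a full nonempty Boolean lattice is
acyclic. The induction starts from singletons, as `P_β` itself is not orthogonal. -/
lemma derivedOrthogonal_of_forall_le {β : L} (haβ : a ≤ β) (hβ : β ≤ b) {T : Finset L}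
    (hT : T.Nonempty) (haT : ∀ t ∈ T, a ≤ t) :
    DerivedOrthogonal (meetModule k β T) (intervalModule k a b) := by
  induction T using Finset.induction_on generalizing β with
  | empty => exact absurd hT Finset.not_nonempty_empty
  | insert t T _ ih =>
    rw [Finset.forall_mem_insert] at haT
    rcases T.eq_empty_or_nonempty with rfl | hT'
    · exact derivedOrthogonal_meetModule_singleton haβ haT.1 hβ
    · exact DerivedOrthogonal.of_shortExact (meetShortComplex_shortExact (k := k) β t T)
        (ih (le_inf haβ haT.1) (inf_le_left.trans hβ) hT' haT.2) (ih haβ hβ hT' haT.2)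

lemma MeetClosed.almostOrthogonal (hab : a ≤ b) {β : L} {T : Finset L} (h : MeetClosed β T b) :
    AlmostOrthogonal k (meetModule k β T) (intervalModule k a b) := by
  induction hn : T.card generalizing β T with
  | zero =>
    obtain rfl := Finset.card_eq_zero.1 hn
    exact almostOrthogonal_of_projective (atMostLine_hom_intervalModule hab)
  | succ n ih =>
    by_cases hT : meetBelow β T ≤ b
    swap
    · exact (derivedOrthogonal_of_meetBelow_not_le hab hT).almostOrthogonal
    by_cases haβ : a ≤ β
    swap
    · exact (derivedOrthogonal_of_not_le hab haβ T).almostOrthogonal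
    have hcard : ∀ t ∈ T, (T.erase t).card = n := fun t ht => by
      rw [Finset.card_erase_of_mem ht, hn, Nat.add_sub_cancel]
    by_cases hβ : β ≤ b
    · by_cases haT : ∀ t ∈ T, a ≤ t
      · exact (derivedOrthogonal_of_forall_le haβ hβ (Finset.card_pos.1 (by omega))
          haT).almostOrthogonal
      · push Not at haT
        obtain ⟨t, ht, hat⟩ := haT
        rw [← Finset.insert_erase ht]
        -- Since `a ≰ β ⊓ t`, the left term is orthogonal.
        exact AlmostOrthogonal.of_shortExact_of_middle
          (meetShortComplex_shortExact (k := k) β t (T.erase t))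
          (derivedOrthogonal_of_not_le hab (fun h => hat (h.trans inf_le_right)) _)
          (ih (h.mono (Finset.erase_subset t T)) (hcard t ht))
    -- This `t` lies in `S₀`: without it the meet is not at most `b`, which makes the middle term
    -- orthogonal.
    · obtain ⟨t, ht, htb⟩ : ∃ t ∈ T, ¬ meetBelow β (T.erase t) ≤ b := by
        by_contra! he
        exact hβ (h.le_of_forall_erase hT he)
      rw [← Finset.insert_erase ht] at h ⊢
      exact AlmostOrthogonal.of_shortExact_of_left
        (meetShortComplex_shortExact (k := k) β t (T.erase t))
        (derivedOrthogonal_of_meetBelow_not_le hab htb) (ih h.inf (hcard t ht))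

omit [HasDerivedCategory.{w} (FGModuleCat.{max u v} (IncidenceAlgebra k L))] in
lemma IsBooleanAntichainBelow.meetModule_eq {α : L} {C : Finset L}
    (hC : IsBooleanAntichainBelow α C) : meetModule k α C = antichainModule k α C := by
  have : (· ⊓ α) '' (C : Set L) = C :=
    (Set.image_congr fun c hc => inf_eq_left.2 (hC.below c hc)).trans (Set.image_id _)
  rw [meetModule, this]

end Main

end LatticeIncidence

/-- For a boolean antichain `C` below `α` and an interval `[a, b]` of a finite lattice, there is at
most one integer `p` with `Hom(M_C^α, [a, b][p]) ≠ 0` in the bounded derived category of finite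
dimensional left modules over the incidence algebra, and this space is then one dimensional. -/
theorem mainTheorem6 {k : Type u} [Field k] {L : Type v} [Lattice L] [Finite L] [DecidableEq L]
    [LocallyFiniteOrder L]
    [HasDerivedCategory.{w} (FGModuleCat.{max u v} (IncidenceAlgebra k L))]
    (α : L) (C : Finset L) (hC : LatticeIncidence.IsBooleanAntichainBelow α C)
    (a b : L) (hab : a ≤ b) :
    (∀ p q : ℤ,
      Nontrivial (LatticeIncidence.toBounded (LatticeIncidence.antichainModule k α C) ⟶
        (LatticeIncidence.toBounded (LatticeIncidence.intervalModule k a b))⟦p⟧) →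
      Nontrivial (LatticeIncidence.toBounded (LatticeIncidence.antichainModule k α C) ⟶
        (LatticeIncidence.toBounded (LatticeIncidence.intervalModule k a b))⟦q⟧) →
      p = q) ∧
    ∀ p : ℤ,
      Nontrivial (LatticeIncidence.toBounded (LatticeIncidence.antichainModule k α C) ⟶
        (LatticeIncidence.toBounded (LatticeIncidence.intervalModule k a b))⟦p⟧) →
      Module.finrank k
        (LatticeIncidence.toBounded (LatticeIncidence.antichainModule k α C) ⟶
          (LatticeIncidence.toBounded (LatticeIncidence.intervalModule k a b))⟦p⟧) = 1 :=
  (hC.meetModule_eq (k := k) ▸ (hC.meetClosed b).almostOrthogonal hab :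
    LatticeIncidence.AlmostOrthogonal k (LatticeIncidence.antichainModule k α C)
      (LatticeIncidence.intervalModule k a b)).bounded
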